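/- Let $n\ge 1$ and let $P$ be an irreducible stochastic matrix on $[n]=\{1,\dots,n\}$ with stationary distribution $\pi$ and $\Pi=\operatorname{diag}(\pi)$. Let $Q=\Pi(P-I)$ be the associated Laplacian and let $X=(X_t)_{t\ge 0}$ be the continuous-time Markov chain on $[n]$ (with right-continuous paths) with rate matrix $Q$. The uniform distribution is stationary for this chain, and the reversed chain is the continuous-time Markov chain with rate matrix $Q^{\top}=\Pi(P^*-I)$, where $P^*=\Pi^{-1}P^{\top}\Pi$. Write $\mathcal L_t^i=\int_0^t \mathbf 1\{X_s=i\}\,ds$ and $\mathcal L_t=(\mathcal L_t^1,\dots,\mathcal L_t^n)$ for the local times. Let $h=(h_1,\dots,h_n)$ with $h_i\ge 0$ for all $i$ and $\sum_i h_i>0$, and let $\ell$ be a $1$-permanental vector with kernel $G_h=(\operatorname{diag}(h)-Q)^{-1}$, that is, a random vector in $\mathbb R_+^n=[0,\infty)^n$ with $$\mathbb E\big[e^{-\sum_i\lambda_i\ell_i}\big]=\det\big(I+\operatorname{diag}(\lambda)G_h\big)^{-1}\qquad\text{for all }\lambda\in\mathbb R_+^n .$$ Let $u:\mathbb R_+^n\to\mathbb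 C$ have property $\mathfrak F$: $u$ is $C^\infty$ on the closed orthant and, for all $k,d\in\mathbb N$, $(1+\|l\|)^{d}\,\|u^{(k)}(l)\|$ is bounded over $l\in\mathbb R_+^n$. Then for every $a\in[n]$, $$\mathbb E[\ell_a u(\ell)]=\int_0^\infty \mathbb E_a\Big[u(\mathcal L_t+\ell)\,\mathbf 1_{X_t=a}\,e^{-\sum_i h_i\mathcal L_t^i}\Big]dt=\int_0^\infty \mathbb E_a^*\Big[u(\mathcal L_t+\ell)\,\mathbf 1_{X_t=a}\,e^{-\sum_i h_i\mathcal L_t^i}\Big]dt .$$ Here $\mathbb E_a$ (respectively $\mathbb E_a^*$) is the joint expectation over the chain (respectively the reversed chain) started at $a$ and over $\ell$, the two being independent; all the expectations and time integrals above converge absolutely. -/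

import Mathlib

open MeasureTheory Set Matrix

noncomputable section

/-- `π` is a stationary probability distribution of the transition matrix `P`. -/
structure IsStationaryDistribution {n : ℕ} (P : Matrix (Fin n) (Fin n) ℝ) (π : Fin n → ℝ) :
    Prop where
  nonneg : ∀ i, 0 ≤ π i
  sum_eq_one : ∑ i, π i = 1
  stationary : π ᵥ* P = π

/-- The normalized Laplacian `Q = Π (P - I)`, `Π = diag(π)`. It is the rate matrix of the
continuous-time chain under consideration. -/
def normalizedLaplacian {n : ℕ} (P : Matrix (Fin n) (Fin n) ℝ) (π : Fin n → ℝ) :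
    Matrix (Fin n) (Fin n) ℝ :=
  Matrix.diagonal π * (P - 1)

/-- The time reversal `P* = Π⁻¹ Pᵀ Π` of `P` with respect to its stationary distribution `π`
(whose entries are all positive when `P` is irreducible). -/
def timeReversal {n : ℕ} (P : Matrix (Fin n) (Fin n) ℝ) (π : Fin n → ℝ) :
    Matrix (Fin n) (Fin n) ℝ :=
  Matrix.of fun i j => π j * P j i / π i

/-- The Laplacian of the reversed chain is the transpose of the Laplacian. -/
theorem normalizedLaplacian_timeReversal {n : ℕ} (P : Matrix (Fin n) (Fin n) ℝ)
    (π : Fin n → ℝ) (hπ : ∀ i, π i ≠ 0) :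
    normalizedLaplacian (timeReversal P π) π = (normalizedLaplacian P π)ᵀ := by
  ext i j
  have h1 : π i * (π j * P j i / π i) = π j * P j i := by
    field_simp [hπ i]
  by_cases hij : i = j
  · subst hij
    simp [normalizedLaplacian, timeReversal, diagonal_mul, mul_sub, h1]
  · simp [normalizedLaplacian, timeReversal, diagonal_mul, mul_sub, h1, hij, Ne.symm hij]

/-- `X` is (a version with right-continuous paths of) the continuous-time Markov chain on `Fin n`
with rate matrix `Q` started at `a`, under the probability measure `μ`: for
`0 = t₀ ≤ t₁ ≤ ⋯ ≤ t_k`,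
`μ (X_{t₀} = i₀, …, X_{t_k} = i_k) = 1{i₀ = a} ∏_j (e^{(t_{j+1} - t_j) Q})_{i_j, i_{j+1}}`.
Only times `t ≥ 0` matter. -/
structure IsMarkovChain {n : ℕ} (Q : Matrix (Fin n) (Fin n) ℝ) (a : Fin n)
    {Ω : Type*} [MeasurableSpace Ω] (μ : Measure Ω) (X : ℝ → Ω → Fin n) : Prop where
  isProbabilityMeasure : IsProbabilityMeasure μ
  measurable : ∀ t, 0 ≤ t → Measurable (X t)
  right_continuous : ∀ ω t, 0 ≤ t → ∀ᶠ s in nhdsWithin t (Ioi t), X s ω = X t ω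
  finite_dimensional : ∀ (k : ℕ) (t : Fin (k + 1) → ℝ) (i : Fin (k + 1) → Fin n),
    t 0 = 0 → Monotone t →
      μ.real {ω | ∀ j, X (t j) ω = i j} =
        (if i 0 = a then 1 else 0) *
          ∏ j : Fin k,
            (NormedSpace.exp ((t j.succ - t j.castSucc) • Q) : Matrix (Fin n) (Fin n) ℝ)
              (i j.castSucc) (i j.succ)

/-- The local time `L_t^i = ∫_0^t 1{X_s = i} ds`. -/
def localTime {n : ℕ} {Ω : Type*} (X : ℝ → Ω → Fin n) (t : ℝ) (ω : Ω) : Fin n → ℝ :=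
  fun i => ∫ s in (0 : ℝ)..t, if X s ω = i then 1 else 0

/-- `ℓ` is an `α`-permanental vector with kernel `G`: a random vector with nonnegative
coordinates and Laplace transform `E[exp(-⟨λ, ℓ⟩)] = det(I + Λ G)^(-α)` for all `λ ≥ 0`. -/
structure IsPermanental {n : ℕ} (α : ℝ) (G : Matrix (Fin n) (Fin n) ℝ)
    {Ω : Type*} [MeasurableSpace Ω] (ν : Measure Ω) (ℓ : Ω → Fin n → ℝ) : Prop where
  isProbabilityMeasure : IsProbabilityMeasure ν
  measurable : Measurable ℓ
  nonneg : ∀ᵐ ω ∂ν, 0 ≤ ℓ ω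
  laplace : ∀ lam : Fin n → ℝ, 0 ≤ lam →
    ∫ ω, Real.exp (-∑ i, lam i * ℓ ω i) ∂ν = (1 + Matrix.diagonal lam * G).det ^ (-α)

/-- `u` is smooth on the closed orthant and it and all its derivatives decay faster than any
polynomial there. Only the values of `u` on the orthant matter. -/
structure PropertyF {n : ℕ} (u : (Fin n → ℝ) → ℂ) : Prop where
  smooth : ContDiffOn ℝ ((⊤ : ℕ∞) : WithTop ℕ∞) u (Ici 0)
  decay : ∀ k d : ℕ, ∃ C : ℝ, ∀ l ∈ Ici (0 : Fin n → ℝ),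
    (1 + ‖l‖) ^ d * ‖iteratedFDerivWithin ℝ k u (Ici 0) l‖ ≤ C

/-- `u(L_t + ℓ) 1{X_t = a} exp(-∑ i, h_i L_t^i)` as a random variable on the product of the
probability spaces of the chain `X` and of the vector `ℓ`, which are thus independent. -/
def dynkinIntegrand {n : ℕ} (h : Fin n → ℝ) (a : Fin n) (u : (Fin n → ℝ) → ℂ)
    {Ω Ω' : Type*} (X : ℝ → Ω → Fin n) (ℓ : Ω' → Fin n → ℝ) (t : ℝ) (p : Ω × Ω') : ℂ :=
  u (localTime X t p.1 + ℓ p.2) * (if X t p.1 = a then 1 else 0) *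
    (Real.exp (-∑ i, h i * localTime X t p.1 i) : ℂ)

end

/-!
Both sides of each identity are integrals of `u` against finite measures on the orthant: the law
of `ℓ` with density `ℓ_a`, and the law of `L_t + ℓ` under `dt ⊗ E_a ⊗ E` with density
`1{X_t = a} exp (-∑ i, h_i L_t^i)`. Finite measures on the orthant are determined by their Laplace
transforms (`ext_of_integral_laplaceKernel`, by Stone–Weierstrass), so it is enough to compare
these.

Let `M = diag h - Q` and `Λ = diag lam`. The Laplace transform of `ℓ` is `det M / det (M + Λ)`, and
its derivative in direction `a` is `-(M + Λ)⁻¹ a a` times itself, by the matrix determinant lemma;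
minus it is the transform of the first measure (`IsPermanental.integral_mul_exp`). For the second one,
independence splits off the transform of `ℓ`, and what remains is
`∫₀^∞ E_a[1{X_t = a} exp (-∑ i, (h_i + lam_i) L_t^i)] dt`. By the Feynman–Kac formula
(`IsMarkovChain.integral_feynmanKac`) the integrand is the entry `(a, a)` of `exp (-t (M + Λ))`, so
the time integral is `(M + Λ)⁻¹ a a` (`Matrix.integral_exp_smul_apply`). The Feynman–Kac formula
itself comes from the finite-dimensional distributions: the local time functional is a limit of
Riemann sums along the right-continuous paths, the expectation of a discretized functional is an
entry of the power of a product of two exponentials, and these powers converge by the Lie–Trotter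
formula (`Matrix.tendsto_exp_mul_exp_pow`).

Invertibility of `M + Λ` is the maximum principle for an irreducible chain killed at a nonzero rate
(`det_diagonal_sub_normalizedLaplacian_ne_zero`). The reversed chain has rate matrix `Qᵀ`, whose
resolvents have the same diagonal entries, so the same computation applies to it.
-/

open Filter Topology
open scoped NNReal BoundedContinuousFunction

/-! ### Matrix exponentials -/

theorem NormedSpace.norm_exp_le {𝔸 : Type*} [NormedRing 𝔸] [NormOneClass 𝔸] [NormedAlgebra ℝ 𝔸]
    [CompleteSpace 𝔸] (x : 𝔸) : ‖NormedSpace.exp x‖ ≤ Real.exp ‖x‖ := by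
  let _ : NormedAlgebra ℚ 𝔸 := NormedAlgebra.restrictScalars ℚ ℝ 𝔸
  have h := NormedSpace.exp_series_hasSum_exp' (𝕂 := ℝ) ‖x‖
  rw [← Real.exp_eq_exp_ℝ] at h
  refine (NormedSpace.exp_series_hasSum_exp' (𝕂 := ℝ) x).norm_le_of_bounded h fun k => ?_
  rw [norm_smul, smul_eq_mul, Real.norm_of_nonneg (by positivity)]
  gcongr
  exact norm_pow_le _ _

theorem norm_pow_sub_pow_le {𝔸 : Type*} [NormedRing 𝔸] [NormOneClass 𝔸] {S T : 𝔸} {M : ℝ}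
    (hS : ‖S‖ ≤ M) (hT : ‖T‖ ≤ M) (hM : 1 ≤ M) (k : ℕ) :
    ‖S ^ k - T ^ k‖ ≤ k * M ^ k * ‖S - T‖ := by
  induction k with
  | zero => simp
  | succ k ih =>
    have hM0 : 0 ≤ M := zero_le_one.trans hM
    have e : S ^ (k + 1) - T ^ (k + 1) = S ^ k * (S - T) + (S ^ k - T ^ k) * T := by
      rw [pow_succ, pow_succ]; noncomm_ring
    have h1 : ‖S ^ k * (S - T)‖ ≤ M ^ (k + 1) * ‖S - T‖ := by
      refine (norm_mul_le _ _).trans (mul_le_mul_of_nonneg_right ?_ (norm_nonneg _))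
      refine (norm_pow_le _ _).trans ((pow_le_pow_left₀ (norm_nonneg _) hS k).trans ?_)
      exact pow_le_pow_right₀ hM k.le_succ
    have h2 : ‖(S ^ k - T ^ k) * T‖ ≤ k * M ^ (k + 1) * ‖S - T‖ := by
      calc ‖(S ^ k - T ^ k) * T‖ ≤ (k * M ^ k * ‖S - T‖) * M :=
            (norm_mul_le _ _).trans (mul_le_mul ih hT (norm_nonneg _) (by positivity))
        _ = k * M ^ (k + 1) * ‖S - T‖ := by ring
    rw [e]
    refine (norm_add_le _ _).trans ((add_le_add h1 h2).trans (le_of_eq ?_))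
    push_cast; ring

/-- The Lie–Trotter product formula. The two factors `exp (x • A) * exp (x • B)` and
`exp (x • (A + B))` have the same derivative at `x = 0`, so they differ by `o(1 / m)` at
`x = 1 / m`, and taking `m`-th powers multiplies this error by `O(m)`. -/
theorem tendsto_exp_mul_exp_pow {𝔸 : Type*} [NormedRing 𝔸] [NormOneClass 𝔸] [NormedAlgebra ℝ 𝔸]
    [CompleteSpace 𝔸] (A B : 𝔸) :
    Tendsto (fun m : ℕ => (NormedSpace.exp ((m : ℝ)⁻¹ • A) * NormedSpace.exp ((m : ℝ)⁻¹ • B)) ^ m)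
      atTop (𝓝 (NormedSpace.exp (A + B))) := by
  let _ : NormedAlgebra ℚ 𝔸 := NormedAlgebra.restrictScalars ℚ ℝ 𝔸
  set F : ℝ → 𝔸 := fun x => NormedSpace.exp (x • A) * NormedSpace.exp (x • B)
    - NormedSpace.exp (x • (A + B)) with hF
  have hder : ∀ C : 𝔸, HasDerivAt (fun x : ℝ => NormedSpace.exp (x • C)) C 0 := fun C => by
    simpa using hasDerivAt_exp_smul_const (𝕂 := ℝ) C (0 : ℝ)
  have hF' : HasDerivAt F 0 0 := by
    have := ((hder A).mul (hder B)).sub (hder (A + B))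
    simpa [hF] using! this
  have hF0 : F 0 = 0 := by simp [hF]
  have hlim : Tendsto (fun m : ℕ => (m : ℝ) * ‖F (m : ℝ)⁻¹‖) atTop (𝓝 0) := by
    have h1 := hF'.tendsto_slope
    have h2 : Tendsto (fun m : ℕ => (m : ℝ)⁻¹) atTop (𝓝[≠] (0 : ℝ)) := by
      refine tendsto_nhdsWithin_iff.2 ⟨tendsto_inv_atTop_nhds_zero_nat, ?_⟩
      filter_upwards [eventually_gt_atTop 0] with m hm
      simp [hm.ne']
    have h3 := (h1.comp h2).norm
    simp only [norm_zero] at h3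
    refine h3.congr fun m => ?_
    simp [slope, hF0, norm_smul]
  set c := ‖A‖ + ‖B‖
  have hbound : ∀ m : ℕ, 0 < m →
      ‖(NormedSpace.exp ((m : ℝ)⁻¹ • A) * NormedSpace.exp ((m : ℝ)⁻¹ • B)) ^ m
        - NormedSpace.exp (A + B)‖ ≤ Real.exp c * (m * ‖F (m : ℝ)⁻¹‖) := by
    intro m hm
    have hm0 : (m : ℝ) ≠ 0 := by positivity
    have e1 : NormedSpace.exp (A + B) = NormedSpace.exp ((m : ℝ)⁻¹ • (A + B)) ^ m := by
      rw [← NormedSpace.exp_nsmul, ← Nat.cast_smul_eq_nsmul ℝ, smul_smul, mul_inv_cancel₀ hm0,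
        one_smul]
    have hn : ∀ C : 𝔸, ‖NormedSpace.exp ((m : ℝ)⁻¹ • C)‖ ≤ Real.exp ((m : ℝ)⁻¹ * ‖C‖) := fun C => by
      refine (NormedSpace.norm_exp_le _).trans ?_
      rw [norm_smul, norm_inv, Real.norm_natCast]
    have hS : ‖NormedSpace.exp ((m : ℝ)⁻¹ • A) * NormedSpace.exp ((m : ℝ)⁻¹ • B)‖
        ≤ Real.exp ((m : ℝ)⁻¹ * c) := by
      refine (norm_mul_le _ _).trans ?_
      rw [mul_add, Real.exp_add]
      exact mul_le_mul (hn A) (hn B) (norm_nonneg _) (Real.exp_pos _).le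
    have hT : ‖NormedSpace.exp ((m : ℝ)⁻¹ • (A + B))‖ ≤ Real.exp ((m : ℝ)⁻¹ * c) := by
      refine (hn _).trans (Real.exp_le_exp.2 ?_)
      gcongr
      exact norm_add_le _ _
    have hM : 1 ≤ Real.exp ((m : ℝ)⁻¹ * c) := Real.one_le_exp (by positivity)
    have := norm_pow_sub_pow_le hS hT hM m
    rw [e1]
    refine this.trans (le_of_eq ?_)
    rw [← Real.exp_nat_mul, ← mul_assoc, mul_inv_cancel₀ hm0, one_mul]
    simp only [hF]; ring
  rw [tendsto_iff_norm_sub_tendsto_zero]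
  refine squeeze_zero' (.of_forall fun _ => norm_nonneg _) ?_
    (by simpa using hlim.const_mul (Real.exp c))
  filter_upwards [eventually_gt_atTop 0] with m hm using hbound m hm

section
open scoped Matrix.Norms.Operator

theorem Matrix.tendsto_exp_mul_exp_pow {n : Type*} [Fintype n] [DecidableEq n]
    (A B : Matrix n n ℝ) :
    Tendsto (fun m : ℕ => (NormedSpace.exp ((m : ℝ)⁻¹ • A) * NormedSpace.exp ((m : ℝ)⁻¹ • B)) ^ m)
      atTop (𝓝 (NormedSpace.exp (A + B))) := by
  cases isEmpty_or_nonempty n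
  · simp [Subsingleton.elim _ (0 : Matrix n n ℝ)]
  · exact _root_.tendsto_exp_mul_exp_pow A B

theorem Matrix.hasDerivAt_exp_smul_apply {n : Type*} [Fintype n] [DecidableEq n]
    (A : Matrix n n ℝ) (i j : n) (t : ℝ) :
    HasDerivAt (fun s : ℝ => NormedSpace.exp (s • A) i j)
      ((NormedSpace.exp (t • A) * A) i j) t := by
  have h := hasDerivAt_exp_smul_const (𝕂 := ℝ) A t
  exact (hasDerivAt_pi.1 (hasDerivAt_pi.1 h i) j)

end

/-- If row `a` of the semigroup `exp (t • A)` stays in `[0, 1]` and `A` is invertible, then row `a`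
of the semigroup is integrable and its integral is row `a` of the resolvent `(-A)⁻¹`. Indeed
`∫₀ᵀ exp (t • A) dt = (exp (T • A) - 1) * A⁻¹` stays bounded, hence row `a` is integrable together
with its derivative and tends to `0`. -/
theorem Matrix.integral_exp_smul_apply {n : Type*} [Fintype n] [DecidableEq n]
    {A : Matrix n n ℝ} (hA : A.det ≠ 0) {a : n}
    (h0 : ∀ t : ℝ, 0 ≤ t → ∀ b, 0 ≤ NormedSpace.exp (t • A) a b)
    (h1 : ∀ t : ℝ, 0 ≤ t → ∀ b, NormedSpace.exp (t • A) a b ≤ 1) (b : n) :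
    IntegrableOn (fun t : ℝ => NormedSpace.exp (t • A) a b) (Ioi 0) ∧
      ∫ t in Ioi (0 : ℝ), NormedSpace.exp (t • A) a b = ((-A)⁻¹) a b := by
  set r : n → ℝ → ℝ := fun c t => NormedSpace.exp (t • A) a c with hr
  have hd : ∀ c t, HasDerivAt (r c) (∑ d, r d t * A d c) t := fun c t =>
    Matrix.hasDerivAt_exp_smul_apply A a c t
  have hcont : ∀ c, Continuous (r c) := fun c =>
    continuous_iff_continuousAt.2 fun t => (hd c t).continuousAt
  -- an antiderivative of `r c`
  have hanti : ∀ c t, HasDerivAt (fun s => ∑ d, r d s * A⁻¹ d c) (r c t) t := by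
    intro c t
    have := HasDerivAt.fun_sum (u := Finset.univ) fun d _ => (hd d t).mul_const (A⁻¹ d c)
    refine this.congr_deriv ?_
    have e : r c t = (NormedSpace.exp (t • A) * A * A⁻¹) a c := by
      rw [Matrix.mul_nonsing_inv_cancel_right _ _ (isUnit_iff_ne_zero.2 hA)]
    rw [e, Matrix.mul_apply]
    simp only [Matrix.mul_apply, hr]
  have hint : ∀ c, IntegrableOn (r c) (Ioi 0) := by
    intro c
    refine integrableOn_Ioi_of_intervalIntegral_norm_bounded
      (∑ d, |A⁻¹ d c| - ∑ d, r d 0 * A⁻¹ d c) 0 (b := fun k : ℕ => (k : ℝ)) (l := atTop)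
      (fun k => (hcont c).integrableOn_Ioc) tendsto_natCast_atTop_atTop (.of_forall fun k => ?_)
    have hk : (0 : ℝ) ≤ k := k.cast_nonneg
    have e : ∫ t in (0 : ℝ)..k, ‖r c t‖ = ∫ t in (0 : ℝ)..k, r c t := by
      refine intervalIntegral.integral_congr fun t ht => ?_
      rw [uIcc_of_le hk] at ht
      exact Real.norm_of_nonneg (h0 t ht.1 c)
    rw [e, intervalIntegral.integral_eq_sub_of_hasDerivAt (fun t _ => hanti c t)
      ((hcont c).intervalIntegrable _ _)]
    refine sub_le_sub_right (Finset.sum_le_sum fun d _ => ?_) _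
    calc r d k * A⁻¹ d c ≤ |r d k| * |A⁻¹ d c| := by rw [← abs_mul]; exact le_abs_self _
      _ ≤ 1 * |A⁻¹ d c| := by
        gcongr
        rw [abs_of_nonneg (h0 _ hk d)]; exact h1 _ hk d
      _ = _ := one_mul _
  have hlim : ∀ c, Tendsto (r c) atTop (𝓝 0) := fun c =>
    tendsto_zero_of_hasDerivAt_of_integrableOn_Ioi (a := 0) (fun t _ => hd c t)
      (integrable_finsetSum _ fun d _ => (hint d).mul_const _) (hint c)
  refine ⟨hint b, ?_⟩
  have hl : Tendsto (fun s => ∑ d, r d s * A⁻¹ d b) atTop (𝓝 0) := by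
    simpa using tendsto_finsetSum Finset.univ fun d _ => (hlim d).mul_const (A⁻¹ d b)
  rw [integral_Ioi_of_hasDerivAt_of_tendsto' (fun t _ => hanti b t) (hint b) hl]
  have : (-A)⁻¹ = -A⁻¹ := by
    refine Matrix.inv_eq_left_inv ?_
    rw [neg_mul_neg, Matrix.nonsing_inv_mul _ (isUnit_iff_ne_zero.2 hA)]
  simp [hr, this, Matrix.one_apply]

/-- Expansion of the entries of a matrix power over paths. -/
theorem Matrix.pow_apply_eq_sum_path {n : Type*} [Fintype n] [DecidableEq n] {R : Type*}
    [CommSemiring R] (K : Matrix n n R) (m : ℕ) (a b : n) :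
    (K ^ m) a b = ∑ p : Fin (m + 1) → n,
      ((if p 0 = a then 1 else 0) * ∏ j : Fin m, K (p j.castSucc) (p j.succ)) *
        if p (Fin.last m) = b then 1 else 0 := by
  induction m generalizing a with
  | zero =>
    rw [← (Equiv.funUnique (Fin 1) n).symm.sum_comp]
    simp [Matrix.one_apply, eq_comm]
  | succ m ih =>
    rw [← (Fin.consEquiv fun _ : Fin (m + 2) => n).sum_comp, Fintype.sum_prod_type]
    simp only [Fin.consEquiv, Equiv.coe_fn_mk, Fin.cons_zero, ite_mul, one_mul, zero_mul]
    rw [Finset.sum_eq_single a (by intro c _ hc; simp [hc]) (by simp), pow_succ', Matrix.mul_apply]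
    simp only [ih, Finset.mul_sum]
    rw [Finset.sum_comm]
    refine Finset.sum_congr rfl fun p _ => ?_
    rw [Finset.sum_eq_single (p 0) (by intro c _ hc; simp [hc.symm]) (by simp)]
    simp [Fin.prod_univ_succ, -Fin.succ_last]

/-! ### The Laplacian of an irreducible stochastic matrix -/

theorem Matrix.det_add_diagonal_single {n : Type*} [Fintype n] [DecidableEq n]
    {M : Matrix n n ℝ} (hM : M.det ≠ 0) (a : n) (ε : ℝ) :
    (M + Matrix.diagonal (Pi.single a ε)).det = M.det * (1 + ε * M⁻¹ a a) := by
  have e : Matrix.diagonal (Pi.single a ε) = Matrix.replicateCol Unit (Pi.single a ε) *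
      Matrix.replicateRow Unit (Pi.single a (1 : ℝ)) := by
    ext i j
    by_cases hi : i = a <;> by_cases hj : j = a <;>
      simp [Matrix.mul_apply, Matrix.diagonal_apply, hi, hj]
    intro h; exact absurd h.symm hj
  rw [e, Matrix.det_add_replicateCol_mul_replicateRow (isUnit_iff_ne_zero.2 hM)]
  congr 1
  simp [Matrix.mul_apply, Matrix.replicateRow, Matrix.replicateCol, Pi.single_apply,
    Matrix.det_unique, mul_comm]

section
variable {n : ℕ} {P : Matrix (Fin n) (Fin n) ℝ} {π : Fin n → ℝ}

/-- A nonempty set of states that is closed under the transitions of an irreducible matrix contains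
every state. -/
theorem Matrix.IsIrreducible.mem_of_closed (hirr : P.IsIrreducible) {S : Set (Fin n)}
    {i : Fin n} (hi : i ∈ S) (hS : ∀ i ∈ S, ∀ j, 0 < P i j → j ∈ S) (j : Fin n) : j ∈ S := by
  have key : ∀ k j, (P ^ k) i j ≠ 0 → j ∈ S := by
    intro k
    induction k with
    | zero =>
      intro j hj
      by_cases hij : i = j
      · exact hij ▸ hi
      · simp [hij] at hj
    | succ k ih =>
      intro j hj
      rw [pow_succ, Matrix.mul_apply] at hj
      obtain ⟨c, -, hc⟩ := Finset.exists_ne_zero_of_sum_ne_zero hj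
      exact hS c (ih c (left_ne_zero_of_mul hc)) j
        ((hirr.nonneg c j).lt_of_ne' (right_ne_zero_of_mul hc))
  obtain ⟨k, -, hk⟩ := (Matrix.isIrreducible_iff_exists_pow_pos hirr.nonneg).1 hirr i j
  exact key k j hk.ne'

theorem IsStationaryDistribution.pos (hπ : IsStationaryDistribution P π) (hirr : P.IsIrreducible)
    (j : Fin n) : 0 < π j := by
  obtain ⟨i, -, hi⟩ : ∃ i ∈ Finset.univ, π i ≠ 0 :=
    Finset.exists_ne_zero_of_sum_ne_zero (by rw [hπ.sum_eq_one]; exact one_ne_zero)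
  refine hirr.mem_of_closed (S := {i | 0 < π i}) ((hπ.nonneg i).lt_of_ne' hi)
    (fun c hc j hj => ?_) j
  have e : ∑ i, π i * P i j = π j := congrFun hπ.stationary j
  have : π c * P c j ≤ ∑ i, π i * P i j :=
    Finset.single_le_sum (f := fun i => π i * P i j)
      (fun i _ => mul_nonneg (hπ.nonneg i) (hirr.nonneg i j)) (Finset.mem_univ c)
  exact (mul_pos hc hj).trans_le (this.trans_eq e)

/-- Maximum principle: at a positive maximum of a function `x` with `Q x = v x`, all neighbours
attain the maximum and `v` vanishes; irreducibility spreads this to all states. -/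
theorem nonpos_of_diagonal_sub_normalizedLaplacian_mulVec_eq_zero
    (hP : P ∈ Matrix.rowStochastic ℝ (Fin n)) (hirr : P.IsIrreducible) (hπ : ∀ i, 0 < π i)
    {v : Fin n → ℝ} (hv : ∀ i, 0 ≤ v i) (hv' : 0 < ∑ i, v i) {x : Fin n → ℝ}
    (hx : (Matrix.diagonal v - normalizedLaplacian P π) *ᵥ x = 0) (i : Fin n) : x i ≤ 0 := by
  have : Nonempty (Fin n) := ⟨i⟩
  obtain ⟨i₀, hi₀⟩ := Finite.exists_max x
  refine (hi₀ i).trans (not_lt.1 fun hm => ?_)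
  -- row `c` of the equation, using that the rows of `P` sum to one
  have heq : ∀ c, v c * x c = π c * ∑ j, P c j * (x j - x c) := by
    intro c
    have h1 := congrFun hx c
    have h2 := Matrix.sum_row_of_mem_rowStochastic hP c
    simp only [normalizedLaplacian, sub_mulVec, Pi.sub_apply, mulVec_diagonal, Pi.zero_apply,
      ← mulVec_mulVec, one_mulVec] at h1
    simp only [mul_sub, Finset.sum_sub_distrib, ← Finset.sum_mul, h2]
    simp only [mulVec, dotProduct] at h1
    linarith
  have hnp : ∀ c, x c = x i₀ → ∀ j, P c j * (x j - x c) ≤ 0 := fun c hc j =>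
    mul_nonpos_of_nonneg_of_nonpos (hirr.nonneg c j) (by linarith [hi₀ j])
  have hzero : ∀ c, x c = x i₀ → ∑ j, P c j * (x j - x c) = 0 := by
    intro c hc
    refine le_antisymm (Finset.sum_nonpos fun j _ => hnp c hc j) (not_lt.1 fun hlt => ?_)
    have h1 := mul_neg_of_pos_of_neg (hπ c) hlt
    rw [← heq c, hc] at h1
    exact h1.not_ge (mul_nonneg (hv c) hm.le)
  have hall : ∀ c, x c = x i₀ := fun c => by
    refine hirr.mem_of_closed (S := {c | x c = x i₀}) (rfl : x i₀ = x i₀) (fun c hc j hj => ?_) c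
    have h1 := (Finset.sum_eq_zero_iff_of_nonpos fun j _ => hnp c hc j).1 (hzero c hc) j
      (Finset.mem_univ j)
    have h2 : x j - x c = 0 := (mul_eq_zero.1 h1).resolve_left hj.ne'
    exact (sub_eq_zero.1 h2).trans hc
  refine hv'.ne' (Finset.sum_eq_zero fun c _ => ?_)
  have h1 := heq c
  rw [hzero c (hall c), mul_zero, hall c] at h1
  exact (mul_eq_zero.1 h1).resolve_right hm.ne'

theorem det_diagonal_sub_normalizedLaplacian_ne_zero
    (hP : P ∈ Matrix.rowStochastic ℝ (Fin n)) (hirr : P.IsIrreducible) (hπ : ∀ i, 0 < π i)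
    {v : Fin n → ℝ} (hv : ∀ i, 0 ≤ v i) (hv' : 0 < ∑ i, v i) :
    (Matrix.diagonal v - normalizedLaplacian P π).det ≠ 0 := by
  intro hdet
  obtain ⟨x, hx0, hx⟩ := Matrix.exists_mulVec_eq_zero_iff.2 hdet
  refine hx0 (funext fun i => le_antisymm
    (nonpos_of_diagonal_sub_normalizedLaplacian_mulVec_eq_zero hP hirr hπ hv hv' hx i) ?_)
  have := nonpos_of_diagonal_sub_normalizedLaplacian_mulVec_eq_zero hP hirr hπ hv hv'
    (x := -x) (by rw [mulVec_neg, hx, neg_zero]) i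
  simpa using this

end

/-! ### Right-continuous paths and local times -/

theorem tendsto_natCeil_mul_div_nhdsGE {s : ℝ} (hs : 0 ≤ s) :
    Tendsto (fun k : ℕ => (⌈s * k⌉₊ : ℝ) / k) atTop (𝓝[≥] s) := by
  refine tendsto_nhdsWithin_iff.2
    ⟨(tendsto_nat_ceil_mul_div_atTop hs).comp tendsto_natCast_atTop_atTop, ?_⟩
  filter_upwards [eventually_gt_atTop 0] with k hk
  have : (0 : ℝ) < k := by exact_mod_cast hk
  exact (le_div_iff₀ this).2 (Nat.le_ceil _)

/-- Riemann sums of a bounded right-continuous function, with the tags at the right endpoints,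
converge to the integral. -/
theorem tendsto_riemannSum_of_rightContinuous {f : ℝ → ℝ} {C : ℝ} (hC : ∀ r, |f r| ≤ C)
    (hf : ∀ r, 0 ≤ r → ContinuousWithinAt f (Ici r) r) :
    Tendsto (fun m : ℕ => (m : ℝ)⁻¹ * ∑ j ∈ Finset.range m, f ((j + 1 : ℕ) / m)) atTop
      (𝓝 (∫ r in (0 : ℝ)..1, f r)) := by
  have hmeas : ∀ m : ℕ, Measurable fun r : ℝ => f (⌈r * m⌉₊ / m) := fun m =>
    (measurable_of_countable fun k : ℕ => f (k / m)).comp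
      (Nat.measurable_ceil.comp (measurable_id.mul_const _))
  have hstep : ∀ m : ℕ, 0 < m → ∫ r in (0 : ℝ)..1, f (⌈r * m⌉₊ / m) =
      (m : ℝ)⁻¹ * ∑ j ∈ Finset.range m, f ((j + 1 : ℕ) / m) := by
    intro m hm
    have hm' : (0 : ℝ) < m := by exact_mod_cast hm
    have h1 := intervalIntegral.sum_integral_adjacent_intervals (μ := volume)
      (f := fun r : ℝ => f (⌈r * m⌉₊ / m)) (a := fun j : ℕ => (j : ℝ) / m) (n := m) fun j _ => by
        refine (intervalIntegrable_const (c := C)).mono_fun (hmeas m).aestronglyMeasurable ?_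
        exact .of_forall fun r => (hC _).trans (le_abs_self C)
    simp only [Nat.cast_zero, zero_div, div_self hm'.ne'] at h1
    rw [← h1, Finset.mul_sum]
    refine Finset.sum_congr rfl fun j _ => ?_
    have hle : (j : ℝ) / m ≤ ((j + 1 : ℕ) : ℝ) / m := by gcongr; simp
    have h2 : ∫ r in ((j : ℝ) / m)..((j + 1 : ℕ) / m), f (⌈r * m⌉₊ / m) =
        ∫ r in ((j : ℝ) / m)..((j + 1 : ℕ) / m), f ((j + 1 : ℕ) / m) := by
      rw [intervalIntegral.integral_of_le hle, intervalIntegral.integral_of_le hle]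
      refine setIntegral_congr_fun measurableSet_Ioc fun r hr => ?_
      have : ⌈r * m⌉₊ = j + 1 := by
        rw [Nat.ceil_eq_iff (Nat.succ_ne_zero _)]
        exact ⟨by simpa using (div_lt_iff₀ hm').1 hr.1, (le_div_iff₀ hm').1 hr.2⟩
      simp only [this]
    rw [h2, intervalIntegral.integral_const, smul_eq_mul]
    congr 1
    push_cast
    ring
  have hlim : Tendsto (fun m : ℕ => ∫ r in (0 : ℝ)..1, f (⌈r * m⌉₊ / m)) atTop
      (𝓝 (∫ r in (0 : ℝ)..1, f r)) := by
    refine intervalIntegral.tendsto_integral_filter_of_dominated_convergence (fun _ => C)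
      (.of_forall fun m => (hmeas m).aestronglyMeasurable)
      (.of_forall fun m => .of_forall fun r _ => hC _) intervalIntegrable_const
      (.of_forall fun r hr => ?_)
    rw [uIoc_of_le zero_le_one] at hr
    exact (hf r hr.1.le).tendsto.comp (tendsto_natCeil_mul_div_nhdsGE hr.1.le)
  refine hlim.congr' ?_
  filter_upwards [eventually_gt_atTop 0] with m hm using hstep m hm

theorem localTime_nonneg {n : ℕ} {Ω : Type*} (X : ℝ → Ω → Fin n) {t : ℝ} (ht : 0 ≤ t) (ω : Ω) :
    0 ≤ localTime X t ω := fun i =>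
  intervalIntegral.integral_nonneg ht fun s _ => by split_ifs <;> simp

section
variable {n : ℕ} {Q : Matrix (Fin n) (Fin n) ℝ} {a : Fin n} {Ω : Type*} [MeasurableSpace Ω]
  {μ : Measure Ω} {X : ℝ → Ω → Fin n}

namespace IsMarkovChain

theorem eventually_nhdsGE (hX : IsMarkovChain Q a μ X) (ω : Ω) {t : ℝ} (ht : 0 ≤ t) :
    ∀ᶠ s in 𝓝[≥] t, X s ω = X t ω := by
  rw [← Ioi_insert, nhdsWithin_insert, eventually_sup, eventually_pure]
  exact ⟨rfl, hX.right_continuous ω t ht⟩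

/-- A right-continuous process is jointly measurable, being the limit of the processes
`X (⌈s k⌉ / k)`. Times are truncated at `0`, as nothing is known about `X` at negative times. -/
theorem measurable_uncurry (hX : IsMarkovChain Q a μ X) :
    Measurable fun p : ℝ × Ω => X (max p.1 0) p.2 := by
  refine measurable_of_tendsto_metrizable
    (f := fun (k : ℕ) (p : ℝ × Ω) => X ((⌈max p.1 0 * k⌉₊ : ℝ) / k) p.2) (fun k => ?_) ?_
  · have h1 : Measurable fun q : ℕ × Ω => X ((q.1 : ℝ) / k) q.2 :=
      measurable_from_prod_countable_right fun j =>
        hX.measurable _ (div_nonneg j.cast_nonneg k.cast_nonneg)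
    exact h1.comp ((Nat.measurable_ceil.comp
      ((measurable_fst.max measurable_const).mul_const _)).prodMk measurable_snd)
  · rw [tendsto_pi_nhds]
    intro p
    have h := (hX.eventually_nhdsGE p.2 (le_max_right p.1 0))
    refine tendsto_nhds_of_eventually_eq ?_
    exact (tendsto_natCeil_mul_div_nhdsGE (le_max_right p.1 0)).eventually h

theorem measurable_indicator_uncurry (hX : IsMarkovChain Q a μ X) (i : Fin n) :
    Measurable fun p : ℝ × Ω => if X (max p.1 0) p.2 = i then (1 : ℝ) else 0 :=
  Measurable.ite (hX.measurable_uncurry (measurableSet_singleton i)) measurable_const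
    measurable_const

theorem intervalIntegrable_comp (hX : IsMarkovChain Q a μ X) (v : Fin n → ℝ) {t : ℝ} (ht : 0 ≤ t)
    (ω : Ω) : IntervalIntegrable (fun s => v (X s ω)) volume 0 t := by
  have hm : Measurable fun s => v (X (max s 0) ω) :=
    (measurable_of_countable v).comp (hX.measurable_uncurry.comp measurable_prodMk_right)
  have h1 : IntervalIntegrable (fun s => v (X (max s 0) ω)) volume 0 t := by
    refine (intervalIntegrable_const (c := ‖v‖)).mono_fun hm.aestronglyMeasurable ?_
    exact .of_forall fun s => (norm_le_pi_norm v _).trans (le_abs_self _)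
  refine h1.congr fun s hs => ?_
  rw [uIoc_of_le ht] at hs
  simp only [max_eq_left hs.1.le]

/-- The additive functional with density `v` is a linear combination of the local times. -/
theorem sum_mul_localTime (hX : IsMarkovChain Q a μ X) (v : Fin n → ℝ) {t : ℝ} (ht : 0 ≤ t)
    (ω : Ω) : ∑ i, v i * localTime X t ω i = ∫ s in (0 : ℝ)..t, v (X s ω) := by
  simp only [localTime]
  have h : ∀ i, IntervalIntegrable (fun s => if X s ω = i then (1 : ℝ) else 0) volume 0 t :=
    fun i => hX.intervalIntegrable_comp (fun c => if c = i then 1 else 0) ht ω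
  simp only [← intervalIntegral.integral_const_mul]
  rw [← intervalIntegral.integral_finsetSum fun i _ => (h i).const_mul (v i)]
  simp

theorem measurable_localTime_uncurry (hX : IsMarkovChain Q a μ X) :
    Measurable fun p : ℝ × Ω => localTime X (max p.1 0) p.2 := by
  refine measurable_pi_lambda _ fun i => ?_
  have h1 : Measurable fun q : (ℝ × Ω) × ℝ => (Ioc 0 (max q.1.1 0)).indicator
      (fun s => if X (max s 0) q.1.2 = i then (1 : ℝ) else 0) q.2 := by
    have hset : MeasurableSet {q : (ℝ × Ω) × ℝ | q.2 ∈ Ioc 0 (max q.1.1 0)} :=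
      (measurableSet_lt measurable_const measurable_snd).inter
        (measurableSet_le measurable_snd (measurable_fst.fst.max measurable_const))
    have := ((hX.measurable_indicator_uncurry i).comp
      (measurable_snd.prodMk measurable_fst.snd : Measurable
        fun q : (ℝ × Ω) × ℝ => (q.2, q.1.2))).indicator hset
    exact this
  have h2 := h1.stronglyMeasurable.integral_prod_right' (ν := volume)
  convert h2.measurable using 1
  funext p
  simp only [localTime]
  rw [integral_indicator (f := fun s => if X (max s 0) p.2 = i then (1 : ℝ) else 0)
    measurableSet_Ioc, intervalIntegral.integral_of_le (le_max_right _ _)]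
  refine setIntegral_congr_fun measurableSet_Ioc fun s hs => ?_
  simp only [max_eq_left hs.1.le]

/-- Expectation of a function of finitely many values of the chain. -/
theorem integral_comp_eq_sum (hX : IsMarkovChain Q a μ X) {m : ℕ} {T : Fin (m + 1) → ℝ}
    (hT0 : T 0 = 0) (hT : Monotone T) (F : (Fin (m + 1) → Fin n) → ℝ) :
    ∫ ω, F (fun j => X (T j) ω) ∂μ = ∑ p, ((if p 0 = a then 1 else 0) *
      ∏ j : Fin m, (NormedSpace.exp ((T j.succ - T j.castSucc) • Q) : Matrix (Fin n) (Fin n) ℝ)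
        (p j.castSucc) (p j.succ)) * F p := by
  have := hX.isProbabilityMeasure
  have hmeas : Measurable fun ω (j : Fin (m + 1)) => X (T j) ω :=
    measurable_pi_lambda _ fun j => hX.measurable _ (hT0 ▸ hT (Fin.zero_le j))
  rw [← integral_map (f := F) hmeas.aemeasurable
    (measurable_of_countable F).aestronglyMeasurable, integral_fintype (.of_finite)]
  refine Finset.sum_congr rfl fun p _ => ?_
  rw [← hX.finite_dimensional m T p hT0 hT, map_measureReal_apply hmeas (measurableSet_singleton p),
    smul_eq_mul]
  congr 3
  ext ω
  simp [funext_iff]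

/-- Expectation of a discretized Feynman–Kac functional as an entry of a Trotter product. -/
theorem integral_discrete_feynmanKac (hX : IsMarkovChain Q a μ X) (v : Fin n → ℝ) {t : ℝ}
    (ht : 0 ≤ t) (b : Fin n) {m : ℕ} (hm : 0 < m) :
    ∫ ω, (if X t ω = b then 1 else 0) * Real.exp (-(t * ((m : ℝ)⁻¹ *
        ∑ j ∈ Finset.range m, v (X (t * ((j + 1 : ℕ) / m)) ω)))) ∂μ =
      ((NormedSpace.exp ((m : ℝ)⁻¹ • t • Q) *
        NormedSpace.exp ((m : ℝ)⁻¹ • t • -Matrix.diagonal v)) ^ m) a b := by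
  have hm' : (m : ℝ) ≠ 0 := by positivity
  set T : Fin (m + 1) → ℝ := fun j => t * ((j : ℕ) / m)
  have hT0 : T 0 = 0 := by simp [T]
  have hT : Monotone T := fun i j hij => by
    simp only [T]
    gcongr
    exact_mod_cast hij
  -- the functional depends on the path only through its values at the grid points `T j`
  have key := hX.integral_comp_eq_sum hT0 hT fun p => (if p (Fin.last m) = b then 1 else 0) *
    Real.exp (-(t * ((m : ℝ)⁻¹ * ∑ j : Fin m, v (p j.succ))))
  have e1 : ∀ ω, ∑ j ∈ Finset.range m, v (X (t * ((j + 1 : ℕ) / m)) ω) =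
      ∑ j : Fin m, v (X (T j.succ) ω) := fun ω => by
    rw [Finset.sum_range]
    rfl
  have e2 : T (Fin.last m) = t := by simp [T, hm']
  simp only [e1]
  simp only [e2] at key
  rw [key, Matrix.pow_apply_eq_sum_path]
  refine Finset.sum_congr rfl fun p _ => ?_
  have e3 : ∀ j : Fin m, T j.succ - T j.castSucc = (m : ℝ)⁻¹ * t := fun j => by
    simp only [T, Fin.val_succ, Fin.val_castSucc]
    push_cast
    field_simp
    ring
  have e4 : NormedSpace.exp ((m : ℝ)⁻¹ • t • -Matrix.diagonal v) =
      Matrix.diagonal fun i => Real.exp (-(t * ((m : ℝ)⁻¹ * v i))) := by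
    rw [Matrix.diagonal_neg, ← Matrix.diagonal_smul, ← Matrix.diagonal_smul, Matrix.exp_diagonal]
    congr 1
    funext i
    rw [Pi.coe_exp, ← Real.exp_eq_exp_ℝ]
    congr 1
    simp only [Pi.smul_apply, smul_eq_mul]
    ring
  have e5 : Real.exp (-(t * ((m : ℝ)⁻¹ * ∑ j : Fin m, v (p j.succ)))) =
      ∏ j : Fin m, Real.exp (-(t * ((m : ℝ)⁻¹ * v (p j.succ)))) := by
    rw [← Real.exp_sum]
    simp only [Finset.mul_sum, Finset.sum_neg_distrib]
  rw [e4, e5]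
  simp only [e3, Matrix.mul_diagonal, smul_smul, Finset.prod_mul_distrib]
  ring

/-- The Feynman–Kac formula. The time integral in the exponent is a limit of Riemann sums, whose
expectations are Trotter products. -/
theorem integral_feynmanKac (hX : IsMarkovChain Q a μ X) {v : Fin n → ℝ} (hv : ∀ i, 0 ≤ v i)
    {t : ℝ} (ht : 0 ≤ t) (b : Fin n) :
    ∫ ω, (if X t ω = b then 1 else 0) * Real.exp (-∑ i, v i * localTime X t ω i) ∂μ =
      (NormedSpace.exp (t • (Q - Matrix.diagonal v)) : Matrix (Fin n) (Fin n) ℝ) a b := by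
  have := hX.isProbabilityMeasure
  set g : ℕ → Ω → ℝ := fun m ω => (if X t ω = b then 1 else 0) * Real.exp (-(t * ((m : ℝ)⁻¹ *
    ∑ j ∈ Finset.range m, v (X (t * ((j + 1 : ℕ) / m)) ω))))
  have hg : ∀ m ω, ‖g m ω‖ ≤ 1 := fun m ω => by
    have h1 : Real.exp (-(t * ((m : ℝ)⁻¹ *
        ∑ j ∈ Finset.range m, v (X (t * ((j + 1 : ℕ) / m)) ω)))) ≤ 1 := by
      refine Real.exp_le_one_iff.2 (neg_nonpos.2 ?_)
      have := Finset.sum_nonneg fun j (_ : j ∈ Finset.range m) =>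
        hv (X (t * ((j + 1 : ℕ) / m)) ω)
      positivity
    simp only [g]
    split_ifs
    · simpa using h1
    · simp
  have hgm : ∀ m, Measurable (g m) := fun m => by
    refine (Measurable.ite (hX.measurable t ht (measurableSet_singleton b)) measurable_const
      measurable_const).mul (Real.measurable_exp.comp (Measurable.neg ?_))
    refine ((Finset.measurable_fun_sum _ fun j _ => ?_).const_mul _).const_mul _
    exact (measurable_of_countable v).comp (hX.measurable _ (by positivity))
  have hlim : ∀ ω, Tendsto (fun m => g m ω) atTop
      (𝓝 ((if X t ω = b then 1 else 0) * Real.exp (-∑ i, v i * localTime X t ω i))) := by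
    intro ω
    refine Tendsto.const_mul _ ((Real.continuous_exp.tendsto _).comp (Tendsto.neg ?_))
    have h1 := tendsto_riemannSum_of_rightContinuous (f := fun r => v (X (t * r) ω)) (C := ‖v‖)
      (fun r => norm_le_pi_norm v _) (fun r hr => by
        refine tendsto_nhds_of_eventually_eq ?_
        have h2 : Tendsto (fun s => t * s) (𝓝[≥] r) (𝓝[≥] (t * r)) := by
          refine tendsto_nhdsWithin_iff.2 ⟨?_, ?_⟩
          · exact ((continuous_const_mul t).tendsto r).mono_left nhdsWithin_le_nhds
          · filter_upwards [self_mem_nhdsWithin] with s hs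
            exact mul_le_mul_of_nonneg_left hs ht
        filter_upwards [h2.eventually (hX.eventually_nhdsGE ω (mul_nonneg ht hr))] with s hs
        rw [hs])
    have h3 := intervalIntegral.mul_integral_comp_mul_left (a := 0) (b := 1)
      (f := fun s => v (X s ω)) t
    rw [mul_zero, mul_one, ← hX.sum_mul_localTime v ht ω] at h3
    rw [← h3]
    exact h1.const_mul t
  have h1 := tendsto_integral_of_dominated_convergence (fun _ => (1 : ℝ))
    (fun m => (hgm m).aestronglyMeasurable) (integrable_const (μ := μ) _)
    (fun m => .of_forall (hg m)) (.of_forall hlim)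
  have h2 := Matrix.tendsto_exp_mul_exp_pow (t • Q) (t • -Matrix.diagonal v)
  rw [← smul_add, ← sub_eq_add_neg] at h2
  have h3 := ((continuous_apply_apply a b).tendsto _).comp h2
  refine tendsto_nhds_unique h1 (h3.congr' ?_)
  filter_upwards [eventually_gt_atTop 0] with m hm
  exact (hX.integral_discrete_feynmanKac v ht b hm).symm

end IsMarkovChain
end

/-! ### Uniqueness of Laplace transforms on the orthant -/

section
variable {n : ℕ}

/-- The exponential `x ↦ exp (-∑ i, lam i * x i)` as a bounded continuous function on the
orthant `ℝ≥0ⁿ`. -/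
noncomputable def laplaceKernel (lam : Fin n → ℝ≥0) : (Fin n → ℝ≥0) →ᵇ ℝ :=
  BoundedContinuousFunction.ofNormedAddCommGroup
    (fun x => Real.exp (-∑ i, (lam i : ℝ) * x i)) (by fun_prop) 1 fun x => by
      rw [Real.norm_of_nonneg (Real.exp_pos _).le]
      exact Real.exp_le_one_iff.2 (neg_nonpos.2 (Finset.sum_nonneg fun i _ => by positivity))

theorem laplaceKernel_apply (lam x : Fin n → ℝ≥0) :
    laplaceKernel lam x = Real.exp (-∑ i, (lam i : ℝ) * x i) := rfl

variable (n) in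
/-- The exponentials form a multiplicative monoid. -/
noncomputable def laplaceMonoid : Submonoid ((Fin n → ℝ≥0) →ᵇ ℝ) where
  carrier := range laplaceKernel
  one_mem' := ⟨0, by ext x; simp [laplaceKernel_apply]⟩
  mul_mem' := by
    rintro _ _ ⟨lam, rfl⟩ ⟨lam', rfl⟩
    refine ⟨lam + lam', ?_⟩
    ext x
    simp [laplaceKernel_apply, ← Real.exp_add, add_mul, Finset.sum_add_distrib, add_comm]

variable (n) in
/-- The algebra generated by the exponentials. -/
noncomputable def laplaceAlgebra : StarSubalgebra ℝ ((Fin n → ℝ≥0) →ᵇ ℝ) where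
  __ := Algebra.adjoin ℝ (laplaceMonoid n : Set ((Fin n → ℝ≥0) →ᵇ ℝ))
  star_mem' := fun {g} h => by
    have : star g = g := by ext x; simp
    rw [this]
    exact h

theorem separatesPoints_laplaceAlgebra :
    ((laplaceAlgebra n).map
      (BoundedContinuousFunction.toContinuousMapStarₐ ℝ)).SeparatesPoints := by
  intro x y hxy
  obtain ⟨i, hi⟩ := Function.ne_iff.1 hxy
  refine ⟨laplaceKernel (Pi.single i 1), ⟨_, ⟨laplaceKernel (Pi.single i 1),
    Algebra.subset_adjoin ⟨Pi.single i 1, rfl⟩, rfl⟩, rfl⟩, fun h => hi ?_⟩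
  have h1 : laplaceKernel (Pi.single i 1) x = laplaceKernel (Pi.single i 1) y := h
  simpa [laplaceKernel_apply, Pi.single_apply, apply_ite ((↑) : ℝ≥0 → ℝ)] using h1

/-- A finite measure on the orthant is determined by its Laplace transform. -/
theorem ext_of_integral_laplaceKernel {ρ ρ' : Measure (Fin n → ℝ≥0)} [IsFiniteMeasure ρ]
    [IsFiniteMeasure ρ'] (h : ∀ lam, ∫ x, laplaceKernel lam x ∂ρ = ∫ x, laplaceKernel lam x ∂ρ') :
    ρ = ρ' := by
  refine ext_of_forall_mem_subalgebra_integral_eq_of_pseudoEMetric_complete_countable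
    (𝕜 := ℝ) (A := laplaceAlgebra n) separatesPoints_laplaceAlgebra fun g hg => ?_
  have hg' : g ∈ Submodule.span ℝ (laplaceMonoid n : Set ((Fin n → ℝ≥0) →ᵇ ℝ)) := by
    have : g ∈ Subalgebra.toSubmodule
      (Algebra.adjoin ℝ (laplaceMonoid n : Set ((Fin n → ℝ≥0) →ᵇ ℝ))) := hg
    rwa [Algebra.adjoin_eq_span, Submonoid.closure_eq] at this
  clear hg
  induction hg' using Submodule.span_induction with
  | mem g hg =>
    obtain ⟨lam, rfl⟩ := hg
    exact h lam
  | zero => simp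
  | add f g _ _ hf hg =>
    simp only [BoundedContinuousFunction.coe_add, Pi.add_apply]
    rw [integral_add (f.integrable _) (g.integrable _), integral_add (f.integrable _)
      (g.integrable _), hf, hg]
  | smul c f _ hf =>
    simp only [BoundedContinuousFunction.coe_smul, integral_smul, hf]

/-- Coordinatewise positive part, as a map onto the orthant `ℝ≥0ⁿ`. -/
def toOrthant (x : Fin n → ℝ) : Fin n → ℝ≥0 := fun i => (x i).toNNReal

theorem measurable_toOrthant : Measurable (toOrthant : (Fin n → ℝ) → Fin n → ℝ≥0) :=
  measurable_pi_lambda _ fun i => (measurable_pi_apply i).real_toNNReal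

theorem coe_toOrthant {x : Fin n → ℝ} (hx : 0 ≤ x) : (fun i => (toOrthant x i : ℝ)) = x :=
  funext fun i => Real.coe_toNNReal _ (hx i)

/-- Integrals against the law of `Z` on the orthant under the measure with density `w`. -/
theorem integral_map_toOrthant {S : Type*} [MeasurableSpace S] {ρ : Measure S} {w : S → ℝ}
    (hw : AEMeasurable w ρ) (hw0 : 0 ≤ᵐ[ρ] w) {Z : S → Fin n → ℝ} (hZ : AEMeasurable Z ρ)
    (hZ0 : ∀ᵐ s ∂ρ, 0 ≤ Z s) {F : Type*} [NormedAddCommGroup F] [NormedSpace ℝ F]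
    {u : (Fin n → ℝ) → F} (hu : ContinuousOn u (Ici 0)) :
    ∫ x : Fin n → ℝ≥0, u (fun i => x i)
        ∂((ρ.withDensity fun s => ENNReal.ofReal (w s)).map fun s => toOrthant (Z s)) =
      ∫ s, w s • u (Z s) ∂ρ := by
  have hu' : Continuous fun x : Fin n → ℝ≥0 => u fun i => (x i : ℝ) :=
    hu.comp_continuous (by fun_prop) fun x i => (x i).coe_nonneg
  have hZ' : AEMeasurable (fun s => toOrthant (Z s)) ρ := measurable_toOrthant.comp_aemeasurable hZ
  rw [integral_map (hZ'.mono_ac (withDensity_absolutelyContinuous _ _)) hu'.aestronglyMeasurable,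
    integral_withDensity_eq_integral_toReal_smul₀ hw.ennreal_ofReal
      (.of_forall fun _ => ENNReal.ofReal_lt_top)]
  refine integral_congr_ae ?_
  filter_upwards [hw0, hZ0] with s hs hs'
  rw [ENNReal.toReal_ofReal hs, coe_toOrthant hs']

/-- Two weighted random vectors in the orthant with the same Laplace transform give the same
weighted integrals of functions that are continuous on the orthant. -/
theorem integral_smul_eq_of_laplace {S S' : Type*} [MeasurableSpace S] [MeasurableSpace S']
    {ρ : Measure S} {ρ' : Measure S'} {w : S → ℝ} {w' : S' → ℝ}
    (hw : Integrable w ρ) (hw' : Integrable w' ρ') (hw0 : 0 ≤ᵐ[ρ] w) (hw0' : 0 ≤ᵐ[ρ'] w')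
    {Z : S → Fin n → ℝ} {Z' : S' → Fin n → ℝ} (hZ : AEMeasurable Z ρ) (hZ' : AEMeasurable Z' ρ')
    (hZ0 : ∀ᵐ s ∂ρ, 0 ≤ Z s) (hZ0' : ∀ᵐ s ∂ρ', 0 ≤ Z' s)
    (hlap : ∀ lam : Fin n → ℝ, 0 ≤ lam →
      ∫ s, w s * Real.exp (-∑ i, lam i * Z s i) ∂ρ =
        ∫ s, w' s * Real.exp (-∑ i, lam i * Z' s i) ∂ρ')
    {F : Type*} [NormedAddCommGroup F] [NormedSpace ℝ F] {u : (Fin n → ℝ) → F}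
    (hu : ContinuousOn u (Ici 0)) :
    ∫ s, w s • u (Z s) ∂ρ = ∫ s, w' s • u (Z' s) ∂ρ' := by
  have := isFiniteMeasure_withDensity_ofReal hw.2
  have := isFiniteMeasure_withDensity_ofReal hw'.2
  have hm : (ρ.withDensity fun s => ENNReal.ofReal (w s)).map (fun s => toOrthant (Z s)) =
      (ρ'.withDensity fun s => ENNReal.ofReal (w' s)).map fun s => toOrthant (Z' s) := by
    refine ext_of_integral_laplaceKernel fun lam => ?_
    have hc : ContinuousOn (fun x : Fin n → ℝ => Real.exp (-∑ i, (lam i : ℝ) * x i)) (Ici 0) := by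
      fun_prop
    have h1 := integral_map_toOrthant hw.aemeasurable hw0 hZ hZ0 hc
    have h2 := integral_map_toOrthant hw'.aemeasurable hw0' hZ' hZ0' hc
    exact h1.trans ((hlap (fun i => lam i) fun i => (lam i).coe_nonneg).trans h2.symm)
  rw [← integral_map_toOrthant hw.aemeasurable hw0 hZ hZ0 hu, hm,
    integral_map_toOrthant hw'.aemeasurable hw0' hZ' hZ0' hu]

end

/-! ### Size-biased permanental vectors -/

/-- If the difference quotients `E[W (1 - exp (-ε Y)) / ε]` converge along `ε = 1 / (k + 1)`, then
`W Y` is integrable, by Fatou's lemma, and its expectation is the limit, by dominated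
convergence. -/
theorem integrable_and_integral_eq_of_tendsto_quotient {Ω : Type*} [MeasurableSpace Ω]
    {ν : Measure Ω} {W Y : Ω → ℝ} (hW : Measurable W) (hY : Measurable Y)
    (hW0 : ∀ ω, 0 ≤ W ω) (hY0 : ∀ᵐ ω ∂ν, 0 ≤ Y ω) {c : ℝ}
    (hint : ∀ k : ℕ, Integrable
      (fun ω => W ω * ((1 - Real.exp (-(1 / (k + 1 : ℝ) * Y ω))) / (1 / (k + 1 : ℝ)))) ν)
    (hc : Tendsto (fun k : ℕ => ∫ ω,
      W ω * ((1 - Real.exp (-(1 / (k + 1 : ℝ) * Y ω))) / (1 / (k + 1 : ℝ))) ∂ν) atTop (𝓝 c)) :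
    Integrable (fun ω => W ω * Y ω) ν ∧ ∫ ω, W ω * Y ω ∂ν = c := by
  set f : ℕ → Ω → ℝ := fun k ω =>
    W ω * ((1 - Real.exp (-(1 / (k + 1 : ℝ) * Y ω))) / (1 / (k + 1 : ℝ)))
  have hlim : ∀ ω, Tendsto (fun k => f k ω) atTop (𝓝 (W ω * Y ω)) := by
    intro ω
    refine Tendsto.const_mul _ ?_
    have h1 : HasDerivAt (fun ε : ℝ => -Real.exp (-(ε * Y ω))) (Y ω) 0 := by
      have := (((hasDerivAt_id (0 : ℝ)).mul_const (Y ω)).neg.exp).neg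
      simpa using! this
    have h2 : Tendsto (fun k : ℕ => 1 / (k + 1 : ℝ)) atTop (𝓝[≠] (0 : ℝ)) :=
      tendsto_nhdsWithin_iff.2 ⟨tendsto_one_div_add_atTop_nhds_zero_nat,
        .of_forall fun k => (Nat.one_div_pos_of_nat).ne'⟩
    refine (h1.tendsto_slope.comp h2).congr fun k => ?_
    simp [slope, div_eq_inv_mul, sub_eq_add_neg, add_comm]
  have hf0 : ∀ k, ∀ᵐ ω ∂ν, 0 ≤ f k ω ∧ f k ω ≤ W ω * Y ω := by
    intro k
    filter_upwards [hY0] with ω hω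
    have hε : (0 : ℝ) < 1 / (k + 1 : ℝ) := Nat.one_div_pos_of_nat
    refine ⟨mul_nonneg (hW0 ω) (div_nonneg (sub_nonneg.2 ?_) hε.le),
      mul_le_mul_of_nonneg_left ((div_le_iff₀ hε).2 ?_) (hW0 ω)⟩
    · exact Real.exp_le_one_iff.2 (neg_nonpos.2 (mul_nonneg hε.le hω))
    · have := Real.add_one_le_exp (-(1 / (k + 1 : ℝ) * Y ω))
      linarith
  have hI : Integrable (fun ω => W ω * Y ω) ν := by
    refine ⟨(hW.mul hY).aestronglyMeasurable, ?_⟩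
    have h1 : ∀ ω, ‖W ω * Y ω‖ₑ = liminf (fun k => ‖f k ω‖ₑ) atTop := fun ω =>
      ((hlim ω).enorm.liminf_eq).symm
    have h2 : ∀ k, ∫⁻ ω, ‖f k ω‖ₑ ∂ν = ENNReal.ofReal (∫ ω, f k ω ∂ν) := fun k => by
      have h3 : 0 ≤ᵐ[ν] f k := (hf0 k).mono fun _ h => h.1
      rw [ofReal_integral_eq_lintegral_ofReal (hint k) h3]
      refine lintegral_congr_ae (h3.mono fun ω h => ?_)
      exact Real.enorm_of_nonneg h
    have h4 : Tendsto (fun k => ∫⁻ ω, ‖f k ω‖ₑ ∂ν) atTop (𝓝 (ENNReal.ofReal c)) := by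
      simp only [h2]
      exact (ENNReal.continuous_ofReal.tendsto c).comp hc
    calc ∫⁻ ω, ‖W ω * Y ω‖ₑ ∂ν = ∫⁻ ω, liminf (fun k => ‖f k ω‖ₑ) atTop ∂ν := by simp only [h1]
      _ ≤ liminf (fun k => ∫⁻ ω, ‖f k ω‖ₑ ∂ν) atTop :=
        lintegral_liminf_le' fun k => (hint k).aestronglyMeasurable.enorm
      _ = ENNReal.ofReal c := h4.liminf_eq
      _ < ⊤ := ENNReal.ofReal_lt_top
  refine ⟨hI, tendsto_nhds_unique (tendsto_integral_of_dominated_convergence _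
    (fun k => (hint k).aestronglyMeasurable) hI (fun k => ?_) (.of_forall hlim)) hc⟩
  filter_upwards [hf0 k] with ω hω
  rw [Real.norm_of_nonneg hω.1]
  exact hω.2

theorem IsPermanental.integrable_exp {n : ℕ} {α : ℝ} {G : Matrix (Fin n) (Fin n) ℝ} {Ω : Type*}
    [MeasurableSpace Ω] {ν : Measure Ω} {ℓ : Ω → Fin n → ℝ} (hℓ : IsPermanental α G ν ℓ)
    {lam : Fin n → ℝ} (hlam : 0 ≤ lam) :
    Integrable (fun ω => Real.exp (-∑ i, lam i * ℓ ω i)) ν := by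
  have := hℓ.isProbabilityMeasure
  have hm := hℓ.measurable
  refine (integrable_const (1 : ℝ)).mono' (by fun_prop) ?_
  filter_upwards [hℓ.nonneg] with ω hω
  rw [Real.norm_of_nonneg (Real.exp_pos _).le]
  exact Real.exp_le_one_iff.2 (neg_nonpos.2 (Finset.sum_nonneg fun i _ =>
    mul_nonneg (hlam i) (hω i)))

/-- The Laplace transform of a `1`-permanental vector with kernel `M⁻¹` size-biased by its
coordinate `a`: differentiating `det (1 + Λ M⁻¹)⁻¹ = det M / det (M + Λ)` in direction `a`
produces the factor `(M + Λ)⁻¹ a a`, by the matrix determinant lemma. -/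
theorem IsPermanental.integral_mul_exp {n : ℕ} {M : Matrix (Fin n) (Fin n) ℝ} {Ω : Type*}
    [MeasurableSpace Ω] {ν : Measure Ω} {ℓ : Ω → Fin n → ℝ} (hℓ : IsPermanental 1 M⁻¹ ν ℓ)
    (hM : ∀ lam : Fin n → ℝ, 0 ≤ lam → (M + Matrix.diagonal lam).det ≠ 0) (a : Fin n)
    {lam : Fin n → ℝ} (hlam : 0 ≤ lam) :
    Integrable (fun ω => Real.exp (-∑ i, lam i * ℓ ω i) * ℓ ω a) ν ∧
      ∫ ω, Real.exp (-∑ i, lam i * ℓ ω i) * ℓ ω a ∂ν =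
        (∫ ω, Real.exp (-∑ i, lam i * ℓ ω i) ∂ν) * (M + Matrix.diagonal lam)⁻¹ a a := by
  have hm := hℓ.measurable
  have hM0 : M.det ≠ 0 := by simpa using hM 0 le_rfl
  have hφ : ∀ lam : Fin n → ℝ, 0 ≤ lam →
      ∫ ω, Real.exp (-∑ i, lam i * ℓ ω i) ∂ν = M.det / (M + Matrix.diagonal lam).det := by
    intro lam hlam
    have e : 1 + Matrix.diagonal lam * M⁻¹ = (M + Matrix.diagonal lam) * M⁻¹ := by
      rw [add_mul, Matrix.mul_nonsing_inv _ (isUnit_iff_ne_zero.2 hM0)]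
    rw [hℓ.laplace lam hlam, Real.rpow_neg_one, e, Matrix.det_mul, Matrix.det_nonsing_inv,
      Ring.inverse_eq_inv', mul_inv, inv_inv, mul_comm, div_eq_mul_inv]
  set g := (M + Matrix.diagonal lam)⁻¹ a a
  have hstep : ∀ ε : ℝ, 0 < ε →
      Integrable (fun ω => Real.exp (-∑ i, lam i * ℓ ω i) *
        ((1 - Real.exp (-(ε * ℓ ω a))) / ε)) ν ∧
      ∫ ω, Real.exp (-∑ i, lam i * ℓ ω i) * ((1 - Real.exp (-(ε * ℓ ω a))) / ε) ∂ν =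
        (∫ ω, Real.exp (-∑ i, lam i * ℓ ω i) ∂ν) * (g / (1 + ε * g)) := by
    intro ε hε
    have hlam' : 0 ≤ lam + Pi.single a ε := add_nonneg hlam (Pi.single_nonneg.2 hε.le)
    have e : ∀ ω, Real.exp (-∑ i, lam i * ℓ ω i) * ((1 - Real.exp (-(ε * ℓ ω a))) / ε) =
        (Real.exp (-∑ i, lam i * ℓ ω i) -
          Real.exp (-∑ i, (lam + Pi.single a ε : Fin n → ℝ) i * ℓ ω i)) / ε := by
      intro ω
      have : ∑ i, (lam + Pi.single a ε : Fin n → ℝ) i * ℓ ω i =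
          ∑ i, lam i * ℓ ω i + ε * ℓ ω a := by
        simp [add_mul, Finset.sum_add_distrib, Pi.single_apply]
      rw [this, neg_add, Real.exp_add]
      ring
    have hd := Matrix.det_add_diagonal_single (hM lam hlam) a ε
    have hd' : M + Matrix.diagonal lam + Matrix.diagonal (Pi.single a ε) =
        M + Matrix.diagonal (lam + Pi.single a ε) := by
      rw [add_assoc, Matrix.diagonal_add]; rfl
    rw [hd'] at hd
    change _ = _ * (1 + ε * g) at hd
    -- the perturbed determinant does not vanish, hence neither does its second factor
    have hne : 1 + ε * g ≠ 0 := right_ne_zero_of_mul (hd ▸ hM _ hlam')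
    have hI1 := hℓ.integrable_exp hlam
    have hI2 := hℓ.integrable_exp hlam'
    simp only [e]
    refine ⟨(hI1.sub hI2).div_const _, ?_⟩
    rw [integral_div, integral_sub hI1 hI2, hφ _ hlam, hφ _ hlam', hd]
    have := hM lam hlam
    field_simp
    ring
  refine integrable_and_integral_eq_of_tendsto_quotient (by fun_prop) (by fun_prop)
    (fun ω => (Real.exp_pos _).le) (hℓ.nonneg.mono fun ω h => h a)
    (fun k => (hstep _ Nat.one_div_pos_of_nat).1) ?_
  have h1 : Tendsto (fun k : ℕ => (∫ ω, Real.exp (-∑ i, lam i * ℓ ω i) ∂ν) *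
      (g / (1 + 1 / (k + 1 : ℝ) * g))) atTop
      (𝓝 ((∫ ω, Real.exp (-∑ i, lam i * ℓ ω i) ∂ν) * (g / (1 + 0 * g)))) := by
    refine Tendsto.const_mul _ (tendsto_const_nhds.div (tendsto_const_nhds.add
      (tendsto_one_div_add_atTop_nhds_zero_nat.mul_const g)) (by simp))
  simp only [zero_mul, add_zero, div_one] at h1
  exact h1.congr fun k => (hstep _ Nat.one_div_pos_of_nat).2.symm

/-! ### The isomorphism theorem -/

theorem norm_indicator_mul_exp_le_one {n : ℕ} {Ω : Type*} (X : ℝ → Ω → Fin n)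
    {v : Fin n → ℝ} (hv : 0 ≤ v) {t : ℝ}
    (ht : 0 ≤ t) (b : Fin n) (ω : Ω) :
    ‖(if X t ω = b then 1 else 0) * Real.exp (-∑ i, v i * localTime X t ω i)‖ ≤ 1 := by
  have h1 : Real.exp (-∑ i, v i * localTime X t ω i) ≤ 1 :=
    Real.exp_le_one_iff.2 (neg_nonpos.2 (Finset.sum_nonneg fun i _ =>
      mul_nonneg (hv i) (localTime_nonneg X ht ω i)))
  split_ifs
  · simpa using h1
  · simp

section
variable {n : ℕ} {Q : Matrix (Fin n) (Fin n) ℝ} {a : Fin n} {Ω Ω' : Type*} [MeasurableSpace Ω]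
  [MeasurableSpace Ω'] {μ : Measure Ω} {X : ℝ → Ω → Fin n} {ν : Measure Ω'}
  {ℓ : Ω' → Fin n → ℝ}

/-- The time integral of the Feynman–Kac semigroup is the resolvent. -/
theorem IsMarkovChain.integral_feynmanKac_Ioi (hX : IsMarkovChain Q a μ X) {v : Fin n → ℝ}
    (hv : 0 ≤ v) (hdet : (Matrix.diagonal v - Q).det ≠ 0) (b : Fin n) :
    IntegrableOn (fun t => ∫ ω, (if X t ω = b then 1 else 0) *
        Real.exp (-∑ i, v i * localTime X t ω i) ∂μ) (Ioi 0) ∧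
      ∫ t in Ioi (0 : ℝ), ∫ ω, (if X t ω = b then 1 else 0) *
        Real.exp (-∑ i, v i * localTime X t ω i) ∂μ = (Matrix.diagonal v - Q)⁻¹ a b := by
  have := hX.isProbabilityMeasure
  have hdet' : (Q - Matrix.diagonal v).det ≠ 0 := by
    rw [← neg_sub, Matrix.det_neg]
    exact mul_ne_zero (pow_ne_zero _ (by norm_num)) hdet
  have h := Matrix.integral_exp_smul_apply hdet' (a := a)
    (fun t ht c => by
      rw [← hX.integral_feynmanKac hv ht c]
      exact integral_nonneg fun ω => mul_nonneg (by split_ifs <;> simp) (Real.exp_pos _).le)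
    (fun t ht c => by
      rw [← hX.integral_feynmanKac hv ht c]
      have h1 := norm_integral_le_of_norm_le_const (μ := μ)
        (.of_forall (norm_indicator_mul_exp_le_one X hv ht c))
      refine (le_abs_self _).trans (h1.trans ?_)
      simp) b
  rw [neg_sub] at h
  have e : ∀ t ∈ Ioi (0 : ℝ), (NormedSpace.exp (t • (Q - Matrix.diagonal v)) :
      Matrix (Fin n) (Fin n) ℝ) a b = ∫ ω, (if X t ω = b then 1 else 0) *
        Real.exp (-∑ i, v i * localTime X t ω i) ∂μ := fun t ht =>
    (hX.integral_feynmanKac hv (mem_Ioi.1 ht).le b).symm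
  exact ⟨h.1.congr_fun e measurableSet_Ioi, (setIntegral_congr_fun measurableSet_Ioi e) ▸ h.2⟩

theorem aestronglyMeasurable_comp_of_continuousOn_orthant {S : Type*} [MeasurableSpace S]
    {ρ : Measure S} {Z : S → Fin n → ℝ} (hZ : AEMeasurable Z ρ) (hZ0 : ∀ᵐ s ∂ρ, 0 ≤ Z s)
    {F : Type*} [NormedAddCommGroup F] {u : (Fin n → ℝ) → F} (hu : ContinuousOn u (Ici 0)) :
    AEStronglyMeasurable (fun s => u (Z s)) ρ := by
  have hu' : Continuous fun x : Fin n → ℝ≥0 => u fun i => (x i : ℝ) :=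
    hu.comp_continuous (by fun_prop) fun x i => (x i).coe_nonneg
  refine (hu'.comp_aestronglyMeasurable
    (measurable_toOrthant.comp_aemeasurable hZ).aestronglyMeasurable).congr ?_
  filter_upwards [hZ0] with s hs
  rw [Function.comp_apply, coe_toOrthant hs]

theorem ae_nonneg_add_prod [SFinite μ] [SFinite ν] (hℓ0 : ∀ᵐ ω ∂ν, 0 ≤ ℓ ω) {t : ℝ} (ht : 0 ≤ t) :
    ∀ᵐ p ∂(μ.prod ν), 0 ≤ localTime X t p.1 + ℓ p.2 :=
  (Measure.quasiMeasurePreserving_snd.ae hℓ0).mono fun p hp =>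
    add_nonneg (localTime_nonneg X ht p.1) hp

/-- The isomorphism for a chain whose resolvents are the logarithmic derivatives of the Laplace
transform of `ℓ`, as expressed by `hlap`. -/
theorem IsMarkovChain.dynkin_isomorphism (hX : IsMarkovChain Q a μ X) {h : Fin n → ℝ} (hh : 0 ≤ h)
    (hdet : ∀ lam : Fin n → ℝ, 0 ≤ lam → (Matrix.diagonal (h + lam) - Q).det ≠ 0)
    [IsProbabilityMeasure ν] (hℓm : Measurable ℓ) (hℓ0 : ∀ᵐ ω ∂ν, 0 ≤ ℓ ω)
    (hℓi : Integrable (fun ω => ℓ ω a) ν)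
    (hlap : ∀ lam : Fin n → ℝ, 0 ≤ lam → ∫ ω, ℓ ω a * Real.exp (-∑ i, lam i * ℓ ω i) ∂ν =
      (∫ ω, Real.exp (-∑ i, lam i * ℓ ω i) ∂ν) * (Matrix.diagonal (h + lam) - Q)⁻¹ a a)
    {u : (Fin n → ℝ) → ℂ} (hu : ContinuousOn u (Ici 0)) {C : ℝ} (hC : ∀ l ∈ Ici 0, ‖u l‖ ≤ C) :
    (∀ t, 0 ≤ t → Integrable (dynkinIntegrand h a u X ℓ t) (μ.prod ν)) ∧
      IntegrableOn (fun t => ∫ p, ‖dynkinIntegrand h a u X ℓ t p‖ ∂(μ.prod ν)) (Ioi 0) ∧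
      ∫ ω, (ℓ ω a : ℂ) * u (ℓ ω) ∂ν =
        ∫ t in Ioi (0 : ℝ), ∫ p, dynkinIntegrand h a u X ℓ t p ∂(μ.prod ν) := by
  have := hX.isProbabilityMeasure
  -- the weight and the random vector, as functions of the time, the chain and `ℓ` jointly; times
  -- are truncated at `0` for the sake of measurability on all of `ℝ`
  set w : ℝ × Ω × Ω' → ℝ := fun s => (if X (max s.1 0) s.2.1 = a then 1 else 0) *
    Real.exp (-∑ i, h i * localTime X (max s.1 0) s.2.1 i)
  set Z : ℝ × Ω × Ω' → Fin n → ℝ := fun s => localTime X (max s.1 0) s.2.1 + ℓ s.2.2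
  have hproj : Measurable fun s : ℝ × Ω × Ω' => (s.1, s.2.1) := by fun_prop
  have hLm : Measurable fun s : ℝ × Ω × Ω' => localTime X (max s.1 0) s.2.1 :=
    hX.measurable_localTime_uncurry.comp hproj
  have hwm : Measurable w := by
    refine ((hX.measurable_indicator_uncurry a).comp hproj).mul (Real.measurable_exp.comp ?_)
    fun_prop
  have hZm : Measurable Z := hLm.add (hℓm.comp measurable_snd.snd)
  have hw1 : ∀ s, ‖w s‖ ≤ 1 := fun s =>
    norm_indicator_mul_exp_le_one X hh (le_max_right s.1 0) a s.2.1
  have hw0 : ∀ s, 0 ≤ w s := fun s => mul_nonneg (by split_ifs <;> simp) (Real.exp_pos _).le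
  have hD : ∀ t, 0 ≤ t → ∀ p, dynkinIntegrand h a u X ℓ t p = w (t, p) • u (Z (t, p)) := by
    intro t ht p
    simp only [dynkinIntegrand, w, Z, max_eq_left ht, Complex.real_smul]
    split_ifs <;> simp [mul_comm]
  set ρ : Measure (ℝ × Ω × Ω') := (volume.restrict (Ioi 0)).prod (μ.prod ν)
  have hZ0 : ∀ᵐ s ∂ρ, 0 ≤ Z s := by
    have h1 : ∀ᵐ s ∂ρ, 0 ≤ ℓ s.2.2 :=
      Measure.quasiMeasurePreserving_snd.ae (Measure.quasiMeasurePreserving_snd.ae hℓ0)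
    exact h1.mono fun s hs => add_nonneg (localTime_nonneg X (le_max_right _ _) _) hs
  -- the weight is integrable, with integral a diagonal entry of the resolvent
  have hwint : Integrable w ρ := by
    refine (integrable_prod_iff hwm.aestronglyMeasurable).2 ⟨.of_forall fun t => ?_, ?_⟩
    · exact (integrable_const (1 : ℝ)).mono' (hwm.comp measurable_prodMk_left).aestronglyMeasurable
        (.of_forall fun p => hw1 _)
    · have h1 := (hX.integral_feynmanKac_Ioi hh (by simpa using hdet 0 le_rfl) a).1
      refine h1.congr_fun (fun t ht => ?_) measurableSet_Ioi
      simp only [Real.norm_of_nonneg (hw0 _)]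
      have ht' : 0 ≤ t := le_of_lt (mem_Ioi.1 ht)
      simp only [w, max_eq_left ht']
      rw [integral_fun_fst (fun ω => (if X t ω = a then 1 else 0) *
        Real.exp (-∑ i, h i * localTime X t ω i))]
      simp
  have hum : AEStronglyMeasurable (fun s => u (Z s)) ρ :=
    aestronglyMeasurable_comp_of_continuousOn_orthant hZm.aemeasurable hZ0 hu
  have huint : Integrable (fun s => w s • u (Z s)) ρ :=
    hwint.smul_bdd C hum (hZ0.mono fun s hs => hC _ hs)
  have hpos : ∀ᵐ t ∂volume.restrict (Ioi (0 : ℝ)), 0 ≤ t :=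
    (ae_restrict_mem measurableSet_Ioi).mono fun t ht => le_of_lt ht
  refine ⟨fun t ht => ?_, ?_, ?_⟩
  · have h1 : dynkinIntegrand h a u X ℓ t = fun p => w (t, p) • u (Z (t, p)) :=
      funext (hD t ht)
    have h2 : ∀ᵐ p ∂(μ.prod ν), 0 ≤ Z (t, p) := by
      simpa only [Z, max_eq_left ht] using ae_nonneg_add_prod hℓ0 ht
    rw [h1]
    have h3 : Integrable (fun p => w (t, p)) (μ.prod ν) :=
      (integrable_const (1 : ℝ)).mono' (hwm.comp measurable_prodMk_left).aestronglyMeasurable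
        (.of_forall fun p => hw1 _)
    exact h3.smul_bdd C (aestronglyMeasurable_comp_of_continuousOn_orthant
      (hZm.comp measurable_prodMk_left).aemeasurable h2 hu) (h2.mono fun p hp => hC _ hp)
  · refine ((integrable_prod_iff huint.aestronglyMeasurable).1 huint).2.congr ?_
    filter_upwards [hpos] with t ht
    simp only [hD t ht]
  -- both sides have Laplace transform `E[exp (-∑ i, lam i * ℓ i)] * (diag (h + lam) - Q)⁻¹ a a`
  · have hL : ∀ lam : Fin n → ℝ, 0 ≤ lam →
        ∫ ω, ℓ ω a * Real.exp (-∑ i, lam i * ℓ ω i) ∂ν =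
          ∫ s, w s * Real.exp (-∑ i, lam i * Z s i) ∂ρ := by
      intro lam hlam
      have h1 : Integrable (fun s => w s * Real.exp (-∑ i, lam i * Z s i)) ρ := by
        refine hwint.mul_bdd (c := 1) (by fun_prop) ?_
        filter_upwards [hZ0] with s hs
        rw [Real.norm_of_nonneg (Real.exp_pos _).le]
        exact Real.exp_le_one_iff.2 (neg_nonpos.2 (Finset.sum_nonneg fun i _ =>
          mul_nonneg (hlam i) (hs i)))
      have h2 := (hX.integral_feynmanKac_Ioi (add_nonneg hh hlam) (hdet lam hlam) a).2
      rw [hlap lam hlam, integral_prod _ h1, ← h2, ← integral_const_mul]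
      refine setIntegral_congr_fun measurableSet_Ioi fun t ht => ?_
      have h3 := integral_prod_mul (μ := μ) (ν := ν)
        (fun ω => (if X t ω = a then 1 else 0) *
          Real.exp (-∑ i, (h + lam) i * localTime X t ω i))
        (fun ω => Real.exp (-∑ i, lam i * ℓ ω i))
      rw [mul_comm, ← h3]
      refine integral_congr_ae (.of_forall fun p => ?_)
      simp only [w, Z, max_eq_left (le_of_lt (mem_Ioi.1 ht)), Pi.add_apply, mul_assoc,
        ← Real.exp_add]
      congr 2
      simp only [add_mul, mul_add, Finset.sum_add_distrib]
      ring
    have h1 := integral_smul_eq_of_laplace hℓi hwint (hℓ0.mono fun ω h => h a) (.of_forall hw0)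
      hℓm.aemeasurable hZm.aemeasurable hℓ0 hZ0 hL hu
    simp only [Complex.real_smul] at h1
    rw [h1]
    simp only [← Complex.real_smul]
    rw [integral_prod _ huint]
    refine setIntegral_congr_fun measurableSet_Ioi fun t ht => ?_
    simp only [hD t (mem_Ioi.1 ht).le]

end

/-- Non-reversible Dynkin isomorphism theorem. Besides the two identities, the conclusion records
that all the expectations and time integrals occurring in them converge absolutely. -/
theorem theorem3p3 {n : ℕ}
    (P : Matrix (Fin n) (Fin n) ℝ) (hP : P ∈ Matrix.rowStochastic ℝ (Fin n))
    (hirr : P.IsIrreducible)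
    (π : Fin n → ℝ) (hπ : IsStationaryDistribution P π)
    (h : Fin n → ℝ) (hh : ∀ i, 0 ≤ h i) (hsum : 0 < ∑ i, h i)
    {Ω₀ Ω₁ Ω₂ : Type*} [MeasurableSpace Ω₀] [MeasurableSpace Ω₁] [MeasurableSpace Ω₂]
    (ν : Measure Ω₀) (ℓ : Ω₀ → Fin n → ℝ)
    (hℓ : IsPermanental 1 (Matrix.diagonal h - normalizedLaplacian P π)⁻¹ ν ℓ)
    (a : Fin n)
    (μ : Measure Ω₁) (X : ℝ → Ω₁ → Fin n)
    (hX : IsMarkovChain (normalizedLaplacian P π) a μ X)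
    (μ' : Measure Ω₂) (X' : ℝ → Ω₂ → Fin n)
    (hX' : IsMarkovChain (normalizedLaplacian (timeReversal P π) π) a μ' X')
    (u : (Fin n → ℝ) → ℂ) (hu : PropertyF u) :
    (Integrable (fun ω => (ℓ ω a : ℂ) * u (ℓ ω)) ν ∧
      (∀ t, 0 ≤ t → Integrable (dynkinIntegrand h a u X ℓ t) (μ.prod ν)) ∧
      (∀ t, 0 ≤ t → Integrable (dynkinIntegrand h a u X' ℓ t) (μ'.prod ν)) ∧
      IntegrableOn (fun t => ∫ p, ‖dynkinIntegrand h a u X ℓ t p‖ ∂(μ.prod ν)) (Ioi 0) ∧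
      IntegrableOn (fun t => ∫ p, ‖dynkinIntegrand h a u X' ℓ t p‖ ∂(μ'.prod ν)) (Ioi 0)) ∧
    ∫ ω, (ℓ ω a : ℂ) * u (ℓ ω) ∂ν =
      ∫ t in Ioi (0 : ℝ), ∫ p, dynkinIntegrand h a u X ℓ t p ∂(μ.prod ν) ∧
    ∫ ω, (ℓ ω a : ℂ) * u (ℓ ω) ∂ν =
      ∫ t in Ioi (0 : ℝ), ∫ p, dynkinIntegrand h a u X' ℓ t p ∂(μ'.prod ν) := by
  have := hℓ.isProbabilityMeasure
  have hπ0 : ∀ i, 0 < π i := hπ.pos hirr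
  have hh' : 0 ≤ h := hh
  set Q := normalizedLaplacian P π
  have hQ : normalizedLaplacian (timeReversal P π) π = Qᵀ :=
    normalizedLaplacian_timeReversal P π fun i => (hπ0 i).ne'
  rw [hQ] at hX'
  have hdet : ∀ lam : Fin n → ℝ, 0 ≤ lam → (Matrix.diagonal (h + lam) - Q).det ≠ 0 := by
    intro lam hlam
    refine det_diagonal_sub_normalizedLaplacian_ne_zero hP hirr hπ0
      (add_nonneg hh' hlam) (hsum.trans_le (Finset.sum_le_sum fun i _ => ?_))
    exact le_add_of_nonneg_right (hlam i)
  have htr : ∀ v : Fin n → ℝ, Matrix.diagonal v - Qᵀ = (Matrix.diagonal v - Q)ᵀ := fun v => by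
    rw [Matrix.transpose_sub, Matrix.diagonal_transpose]
  have hadd : ∀ lam : Fin n → ℝ, Matrix.diagonal h - Q + Matrix.diagonal lam =
      Matrix.diagonal (h + lam) - Q := fun lam => by
    rw [sub_add_eq_add_sub, Matrix.diagonal_add]
    rfl
  have hbias : ∀ {lam : Fin n → ℝ}, 0 ≤ lam → _ := fun hlam =>
    hℓ.integral_mul_exp (fun lam hlam => hadd lam ▸ hdet lam hlam) a hlam
  have hℓi : Integrable (fun ω => ℓ ω a) ν := by simpa using (hbias le_rfl).1
  have hlap : ∀ lam : Fin n → ℝ, 0 ≤ lam → ∫ ω, ℓ ω a * Real.exp (-∑ i, lam i * ℓ ω i) ∂ν =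
      (∫ ω, Real.exp (-∑ i, lam i * ℓ ω i) ∂ν) * (Matrix.diagonal (h + lam) - Q)⁻¹ a a := by
    intro lam hlam
    rw [← hadd, ← (hbias hlam).2]
    simp only [mul_comm]
  have huc : ContinuousOn u (Ici 0) := hu.smooth.continuousOn
  obtain ⟨C, hC⟩ := hu.decay 0 0
  have hC' : ∀ l ∈ Ici (0 : Fin n → ℝ), ‖u l‖ ≤ C := fun l hl => by simpa using hC l hl
  obtain ⟨h1, h2, h3⟩ := hX.dynkin_isomorphism hh' hdet hℓ.measurable hℓ.nonneg hℓi hlap huc hC'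
  obtain ⟨h1', h2', h3'⟩ := hX'.dynkin_isomorphism hh'
    (fun lam hlam => by rw [htr, Matrix.det_transpose]; exact hdet lam hlam)
    hℓ.measurable hℓ.nonneg hℓi
    (fun lam hlam => by
      rw [htr, ← Matrix.transpose_nonsing_inv, Matrix.transpose_apply]
      exact hlap lam hlam) huc hC'
  refine ⟨⟨?_, h1, h1', h2, h2'⟩, h3, h3'⟩
  refine hℓi.ofReal.mul_bdd (c := C) (aestronglyMeasurable_comp_of_continuousOn_orthant
    hℓ.measurable.aemeasurable hℓ.nonneg huc) (hℓ.nonneg.mono fun ω hω => hC' _ hω)
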